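/- Let $(M,g)$ be a closed Riemannian $3$-manifold with a fixed spin structure and spinor bundle $\Sigma M$. Let $G=\mathrm{SU}(N)$ with $N\neq 1$, or $G=\mathrm{U}(N)$; fix an $\mathrm{Ad}$-invariant positive definite inner product on the Lie algebra $\mathfrak g$ of $G$, let $G\to P\to M$ be a principal $G$-bundle, $\mathrm{ad}(P)=P\times_{\mathrm{Ad}}\mathfrak g$, and let $E=P\times_{\mathrm{st}}\mathbb C^N$ be the Hermitian vector bundle associated with the standard representation. For $\Psi\in\Gamma(\Sigma M\otimes E)$ let the Dirac current $J(\Psi)\in\Omega^1(M;\mathrm{ad}(P))$ be determined by $$\langle \eta, J(\Psi)\rangle=-\tfrac12\Big\langle \Psi,\ \sum_{k=1}^3 e_k\cdot \mathrm{st}_*(\eta(e_k))\Psi\Big\rangle\qquad\text{for all }\eta\in\Omega^1(M;\mathrm{ad}(P)),$$ where $(e_k)$ is a local orthonormal frame. For a connection one-form $\omega$ on $P$ let $D_\omega=\sum_k e_k\cdot\widetilde\nabla^\omega_{e_k}$ be the twisted Dirac operator on $\Gamma(\Sigma M\otimes E)$. Call $\omega$ *decoupling* if $J(\Psi)=0$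 for every $\Psi\in\ker D_\omega$, and *perturbation minimal* if $\omega$ has a neighbourhood $U$ in the $C^\infty$ topology on the space of connection one-forms such that $\dim\ker D_\vartheta\ge\dim\ker D_\omega$ for all $\vartheta\in U$. Then $J$ has trivial kernel: for $\Psi\in\Gamma(\Sigma M\otimes E)$ one has $J(\Psi)=0$ if and only if $\Psi=0$. Moreover, every decoupling connection one-form $\omega$ is perturbation minimal and satisfies $\dim\ker D_\omega=0$. -/

import Mathlib

open scoped Manifold ContDiff Topology Matrix Kronecker

noncomputable section

namespace DiracYangMills

/-! ### Matrix groups and their Lie algebras -/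

/-- Complex `N × N` matrices. -/
abbrev Mat (N : ℕ) : Type := Matrix (Fin N) (Fin N) ℂ

/-- The model space of a `3`-manifold. -/
abbrev E3 : Type := EuclideanSpace ℝ (Fin 3)

/-- The Lie algebra of a closed matrix group `G`: the matrices `A` whose one-parameter group
`t ↦ exp (t A)` stays in `G`. (For a closed group these matrices already form a real subspace, so
taking the span adds nothing.) -/
def lieAlg {N : ℕ} (G : Submonoid (Mat N)) : Submodule ℝ (Mat N) :=
  Submodule.span ℝ {A | ∀ t : ℝ, NormedSpace.exp (t • A) ∈ G}

/-- An `Ad`-invariant positive definite inner product on the Lie algebra of `G`. -/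
structure AdInvariantInnerProduct {N : ℕ} (G : Submonoid (Mat N)) where
  form : LinearMap.BilinForm ℝ (lieAlg G)
  symm : ∀ A B, form A B = form B A
  pos : ∀ A, A ≠ 0 → 0 < form A A
  ad_invariant : ∀ h ∈ G, ∀ A B A' B' : lieAlg G,
    (A' : Mat N) = h * (A : Mat N) * h⁻¹ → (B' : Mat N) = h * (B : Mat N) * h⁻¹ →
      form A' B' = form A B

theorem AdInvariantInnerProduct.nondegenerate {N : ℕ} {G : Submonoid (Mat N)}
    (κ : AdInvariantInnerProduct G) : κ.form.Nondegenerate := by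
  constructor
  · intro A hA
    by_contra h
    exact (κ.pos A h).ne' (hA A)
  · intro A hA
    by_contra h
    exact (κ.pos A h).ne' (hA A)

/-- The group `SU(2)`, in its role as `Spin(3)`. -/
abbrev Spin3 : Submonoid (Mat 2) := Matrix.specialUnitaryGroup (Fin 2) ℂ

/-- The Pauli matrices `σ₁, σ₂, σ₃`. -/
def pauli : Fin 3 → Mat 2 :=
  ![!![0, 1; 1, 0], !![0, -Complex.I; Complex.I, 0], !![1, 0; 0, -1]]

/-- Clifford multiplication by the `k`-th standard basis vector of `ℝ³` on the spinor module `ℂ²`,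
`γ_k = - i σ_k`; thus `γ_k² = -1`. -/
def gamma (k : Fin 3) : Mat 2 := (-Complex.I) • pauli k

/-- The double covering `Spin(3) = SU(2) → SO(3)`, `u ↦ R(u)`, determined by
`u σ_j u* = ∑ i, R(u)_{ij} σ_i`. -/
def spinCover (u : Spin3) : Matrix (Fin 3) (Fin 3) ℝ :=
  Matrix.of fun i j =>
    (1 / 2 : ℝ) * (Matrix.trace (pauli i * ((u : Mat 2) * pauli j * (u : Mat 2)ᴴ))).re

/-! ### Principal bundles and connections -/

section Bundles

/-- A smooth principal `G`-bundle `G → P → M`, where `M` is a `3`-manifold, `P` a `d`-manifold and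
`G` a (closed, hence embedded) group of matrices: a smooth right action of `G` on `P` which is
simply transitive on the fibres of a smooth projection, and which is locally trivial. Since `G` is
embedded in the space of matrices, a map into `G` is smooth iff it is smooth as a map into matrices,
and a map out of `P × G` is smooth iff its composites with all smooth maps from Euclidean spaces
to `P × G` are smooth. -/
structure PrincipalBundle {N : ℕ} (G : Submonoid (Mat N))
    (M : Type*) [TopologicalSpace M] [ChartedSpace E3 M] (d : ℕ)
    (P : Type*) [TopologicalSpace P] [ChartedSpace (EuclideanSpace ℝ (Fin d)) P] where
  proj : P → M
  smooth_proj : ContMDiff (𝓡 d) (𝓡 3) ∞ proj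
  act : P → G → P
  act_one : ∀ p, act p 1 = p
  act_mul : ∀ p h h', act p (h * h') = act (act p h) h'
  smooth_act : ∀ (k : ℕ) (c : EuclideanSpace ℝ (Fin k) → P) (h : EuclideanSpace ℝ (Fin k) → G)
    (w : EuclideanSpace ℝ (Fin k)),
    ContMDiffAt (𝓡 k) (𝓡 d) ∞ c w →
    ContMDiffAt (𝓡 k) 𝓘(ℝ, Fin N → Fin N → ℂ) ∞ (fun v i j => (h v : Mat N) i j) w →
    ContMDiffAt (𝓡 k) (𝓡 d) ∞ (fun v => act (c v) (h v)) w
  proj_act : ∀ p h, proj (act p h) = proj p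
  simply_transitive : ∀ p p', proj p = proj p' → ∃! h, act p h = p'
  /-- Around each point there are a smooth local section `s` and a smooth map `τ` into `G` with
  `p = s (proj p) · τ p`, so that `(x, h) ↦ s x · h` and `(proj, τ)` are inverse smooth maps between
  `U × G` and `proj⁻¹ U`. -/
  locally_trivial : ∀ x : M, ∃ (U : Set M) (s : M → P) (τ : P → G), IsOpen U ∧ x ∈ U ∧
    ContMDiffOn (𝓡 3) (𝓡 d) ∞ s U ∧ (∀ y ∈ U, proj (s y) = y) ∧
    ContMDiffOn (𝓡 d) 𝓘(ℝ, Fin N → Fin N → ℂ) ∞ (fun p i j => (τ p : Mat N) i j) (proj ⁻¹' U) ∧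
    ∀ p ∈ proj ⁻¹' U, act (s (proj p)) (τ p) = p

variable {N : ℕ} {G : Submonoid (Mat N)}
  {M : Type*} [TopologicalSpace M] [ChartedSpace E3 M] {d : ℕ}
  {P : Type*} [TopologicalSpace P] [ChartedSpace (EuclideanSpace ℝ (Fin d)) P]

/-- A local gauge of a principal bundle: a smooth section over an open subset `dom` of `M`
(the values of `toFun` outside `dom` play no role). -/
structure LocalGauge (B : PrincipalBundle G M d P) where
  dom : Set M
  isOpen_dom : IsOpen dom
  toFun : M → P
  smooth : ContMDiffOn (𝓡 3) (𝓡 d) ∞ toFun dom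
  proj_toFun : ∀ x ∈ dom, B.proj (toFun x) = x

/-- A connection one-form `ω ∈ Ω¹(P; 𝔤)` on a principal bundle. -/
structure Connection [IsManifold (𝓡 d) ∞ P] (B : PrincipalBundle G M d P) where
  form : ∀ p : P, TangentSpace (𝓡 d) p →L[ℝ] Mat N
  mem_lieAlg : ∀ p v, form p v ∈ lieAlg G
  smooth : ContMDiff (𝓡 d).tangent 𝓘(ℝ, Fin N → Fin N → ℂ) ∞
    (fun (v : TangentBundle (𝓡 d) P) i j => form v.proj v.snd i j)
  /-- `ω` is `Ad`-equivariant: `R_h^* ω = Ad(h⁻¹) ω`. -/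
  equivariant : ∀ (p : P) (h : G) (v : TangentSpace (𝓡 d) p),
    form (B.act p h) (mfderiv (𝓡 d) (𝓡 d) (fun p' => B.act p' h) p v)
      = (h : Mat N)⁻¹ * form p v * (h : Mat N)
  /-- `ω` reproduces the generators of the action: on the velocity of `t ↦ p · exp (t A)` at
  `t = 0` it takes the value `A`. -/
  fundamental : ∀ (p : P) (A : Mat N) (hA : ∀ t : ℝ, NormedSpace.exp (t • A) ∈ G),
    form (B.act p ⟨NormedSpace.exp ((0 : ℝ) • A), hA 0⟩)
      (mfderiv 𝓘(ℝ, ℝ) (𝓡 d) (fun t : ℝ => B.act p ⟨NormedSpace.exp (t • A), hA t⟩) 0 (1 : ℝ)) = A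

variable [IsManifold (𝓡 d) ∞ P] {B : PrincipalBundle G M d P}

/-- The local gauge potential `(s^* ω)_x (X)`. -/
def Connection.potential (θ : Connection B) (s : LocalGauge B) (x : M) :
    TangentSpace (𝓡 3) x →L[ℝ] Mat N :=
  (θ.form (s.toFun x)).comp (mfderiv (𝓡 3) (𝓡 d) s.toFun x)

/-- The components `A_1, A_2, A_3` (matrix-valued functions on an open subset of `ℝ³`) of the gauge
potential in the chart `φ` of `M` around `x₀`: `A_a` is the value of `(s ∘ φ⁻¹)^* ω` on the `a`-th
coordinate vector field. -/
def Connection.chartPotential (θ : Connection B) (s : LocalGauge B) (x₀ : M) :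
    E3 → (Fin 3 → Fin N → Fin N → ℂ) := fun y a i j =>
  θ.form (s.toFun ((chartAt E3 x₀).symm y))
    (mfderiv (𝓡 3) (𝓡 d) (s.toFun ∘ (chartAt E3 x₀).symm) y (EuclideanSpace.single a (1 : ℝ))) i j

/-- The `C^∞` topology on the space of connections: convergence means locally uniform convergence
of the gauge potentials together with all their partial derivatives, in all local gauges and
charts. -/
instance Connection.instTopologicalSpace : TopologicalSpace (Connection B) :=
  ⨅ (s : LocalGauge B) (x₀ : M) (n : ℕ), TopologicalSpace.induced
    (fun θ : Connection B => UniformOnFun.ofFun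
      {K : Set E3 | IsCompact K ∧
        K ⊆ (chartAt E3 x₀).target ∩ (chartAt E3 x₀).symm ⁻¹' s.dom}
      (iteratedFDeriv ℝ n (θ.chartPotential s x₀)))
    inferInstance

end Bundles

/-! ### Spin structures and twisted spinors -/

section Spin

variable {M : Type*} [TopologicalSpace M] [ChartedSpace E3 M] [IsManifold (𝓡 3) ∞ M]

/-- A spin structure on a Riemannian `3`-manifold `(M, g)`: a principal `Spin(3)`-bundle `Q → M`
together with a smooth map to the bundle of `g`-orthonormal frames, covering the identity of `M` and
equivariant along `Spin(3) → SO(3)`. The image of this map is a principal `SO(3)`-bundle of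
orthonormal frames, so that an orientation of `M` is part of the datum, and `Q` is a double covering
of the bundle of positively oriented orthonormal frames. -/
structure SpinStructure
    (g : Bundle.ContMDiffRiemannianMetric (𝓡 3) ∞ E3 (fun x : M => TangentSpace (𝓡 3) x))
    (e : ℕ) (Q : Type*) [TopologicalSpace Q] [ChartedSpace (EuclideanSpace ℝ (Fin e)) Q]
    extends PrincipalBundle Spin3 M e Q where
  frame : ∀ q : Q, Fin 3 → TangentSpace (𝓡 3) (proj q)
  smooth_frame : ∀ i, ContMDiff (𝓡 e) (𝓡 3).tangent ∞
    (fun q => (⟨proj q, frame q i⟩ : TangentBundle (𝓡 3) M))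
  orthonormal : ∀ q i j, g.inner (proj q) (frame q i) (frame q j) = if i = j then 1 else 0
  equivariant : ∀ q u j, (⟨proj (act q u), frame (act q u) j⟩ : TangentBundle (𝓡 3) M) =
    ⟨proj q, ∑ i, spinCover u i j • frame q i⟩

variable {g : Bundle.ContMDiffRiemannianMetric (𝓡 3) ∞ E3 (fun x : M => TangentSpace (𝓡 3) x)}
  {e : ℕ} {Q : Type*} [TopologicalSpace Q] [ChartedSpace (EuclideanSpace ℝ (Fin e)) Q]

/-- The local orthonormal frame `e₁, e₂, e₃` of `TM` determined by a local section of the spin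
bundle (it is used on the domain of that section only). -/
def SpinStructure.localFrame (S : SpinStructure g e Q)
    (ε : LocalGauge S.toPrincipalBundle) (k : Fin 3) : ∀ x : M, TangentSpace (𝓡 3) x :=
  fun x => (S.frame (ε.toFun x) k : E3)

/-- The coefficients `g([e_i, e_j], e_k)` of a local orthonormal frame. -/
def SpinStructure.structureCoeff (S : SpinStructure g e Q)
    (ε : LocalGauge S.toPrincipalBundle) (x : M) (i j k : Fin 3) : ℝ :=
  g.inner x (VectorField.mlieBracket (𝓡 3) (S.localFrame ε i) (S.localFrame ε j) x)
    (S.localFrame ε k x)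

/-- The coefficients `g(∇_{e_k} e_i, e_j)` of the Levi-Civita connection of `g` with respect to a
local orthonormal frame, as given by the Koszul formula. -/
def SpinStructure.leviCivitaCoeff (S : SpinStructure g e Q)
    (ε : LocalGauge S.toPrincipalBundle) (x : M) (k i j : Fin 3) : ℝ :=
  (1 / 2 : ℝ) * (S.structureCoeff ε x k i j - S.structureCoeff ε x k j i
    - S.structureCoeff ε x i j k)

/-- The endomorphism `¼ ∑ i j, g(∇_{e_k} e_i, e_j) γ_i γ_j` of `ℂ²`: the spinorial Levi-Civita
connection is `∇_{e_k} ψ = e_k(ψ) + ¼ ∑ i j, g(∇_{e_k} e_i, e_j) e_i · e_j · ψ`. -/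
def SpinStructure.spinCoeff (S : SpinStructure g e Q)
    (ε : LocalGauge S.toPrincipalBundle) (x : M) (k : Fin 3) : Mat 2 :=
  (1 / 4 : ℂ) • ∑ i, ∑ j, (S.leviCivitaCoeff ε x k i j : ℂ) • (gamma i * gamma j)

variable {N : ℕ} {G : Submonoid (Mat N)} {d : ℕ}
  {P : Type*} [TopologicalSpace P] [ChartedSpace (EuclideanSpace ℝ (Fin d)) P]

/-- The fibre `ℂ² ⊗ ℂ^N` of the bundle of twisted spinors. An endomorphism `a ⊗ b` of it is the
Kronecker product `a ⊗ₖ b` of matrices. -/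
abbrev Fibre (N : ℕ) : Type := Fin 2 × Fin N → ℂ

/-- The space `Γ(ΣM ⊗ E)` of smooth sections of the twisted spinor bundle, where
`ΣM = Q ×_{Spin(3)} ℂ²` and `E = P ×_G ℂ^N` for the standard representations. As usual, a section
of the bundle associated with the `Spin(3) × G`-bundle `Q ×_M P` is the same as an equivariant
function `Ψ` on `Q ×_M P`: its value at `x` is `[(q, p), Ψ q p]`, for any `q`, `p` over `x`. We
extend such functions to `Q × P` by zero. -/
def TwistedSpinor (S : SpinStructure g e Q) (B : PrincipalBundle G M d P) :
    Submodule ℂ (Q → P → Fibre N) where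
  carrier := {Ψ |
    (∀ q p, S.proj q ≠ B.proj p → Ψ q p = 0) ∧
    (∀ q p (u : Spin3) (h : G), ((u : Mat 2) ⊗ₖ (h : Mat N)) *ᵥ Ψ (S.act q u) (B.act p h) = Ψ q p) ∧
    ∀ (ε : LocalGauge S.toPrincipalBundle) (s : LocalGauge B),
      ContMDiffOn (𝓡 3) 𝓘(ℝ, Fibre N) ∞
        (fun x => Ψ (ε.toFun x) (s.toFun x)) (ε.dom ∩ s.dom)}
  zero_mem' := ⟨fun _ _ _ => rfl, fun _ _ _ _ => by simp, fun _ _ => contMDiffOn_const⟩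
  add_mem' := by
    rintro Ψ Φ ⟨h1, h2, h3⟩ ⟨k1, k2, k3⟩
    refine ⟨fun q p h => by simp [h1 q p h, k1 q p h], fun q p u h => ?_,
      fun ε s => (h3 ε s).add (k3 ε s)⟩
    simp only [Pi.add_apply, Matrix.mulVec_add, h2, k2]
  smul_mem' := by
    rintro c Ψ ⟨h1, h2, h3⟩
    refine ⟨fun q p h => by simp [h1 q p h], fun q p u h => ?_, fun ε s => ?_⟩
    · simp only [Pi.smul_apply, Matrix.mulVec_smul, h2]
    · have hc : ContMDiff 𝓘(ℝ, Fibre N) 𝓘(ℝ, Fibre N) ∞ (fun v : Fibre N => c • v) :=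
        (contDiff_const_smul c).contMDiff
      exact hc.comp_contMDiffOn (h3 ε s)

/-- The local representative `ψ` of a twisted spinor: `Ψ = [ε × s, ψ]`. -/
def localRep {S : SpinStructure g e Q} {B : PrincipalBundle G M d P}
    (Ψ : TwistedSpinor S B) (ε : LocalGauge S.toPrincipalBundle) (s : LocalGauge B) :
    M → Fibre N :=
  fun x => (Ψ : Q → P → Fibre N) (ε.toFun x) (s.toFun x)

/-- The differential `dψ_x` of the local representative. -/
def dLocalRep {S : SpinStructure g e Q} {B : PrincipalBundle G M d P}
    (Ψ : TwistedSpinor S B) (ε : LocalGauge S.toPrincipalBundle) (s : LocalGauge B) (x : M) :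
    TangentSpace (𝓡 3) x →L[ℝ] Fibre N :=
  mfderiv (𝓡 3) 𝓘(ℝ, Fibre N) (localRep Ψ ε s) x

/-- The twisted covariant derivative `∇̃_{e_k} Ψ` in a local gauge:
`e_k(ψ) + (¼ ∑ i j, g(∇_{e_k} e_i, e_j) γ_i γ_j) ψ + (s^* ω)(e_k) ψ`. -/
def covDeriv [IsManifold (𝓡 d) ∞ P] (S : SpinStructure g e Q) {B : PrincipalBundle G M d P}
    (θ : Connection B) (Ψ : TwistedSpinor S B)
    (ε : LocalGauge S.toPrincipalBundle) (s : LocalGauge B) (k : Fin 3) (x : M) : Fibre N :=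
  dLocalRep Ψ ε s x (S.localFrame ε k x)
    + (S.spinCoeff ε x k ⊗ₖ (1 : Mat N)) *ᵥ localRep Ψ ε s x
    + ((1 : Mat 2) ⊗ₖ (θ.potential s x (S.localFrame ε k x) : Mat N)) *ᵥ localRep Ψ ε s x

theorem mdifferentiableAt_localRep {S : SpinStructure g e Q}
    {B : PrincipalBundle G M d P} (Ψ : TwistedSpinor S B)
    (ε : LocalGauge S.toPrincipalBundle) (s : LocalGauge B) {x : M} (hx : x ∈ ε.dom ∩ s.dom) :
    MDifferentiableAt (𝓡 3) 𝓘(ℝ, Fibre N) (localRep Ψ ε s) x :=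
  ((Ψ.2.2.2 ε s).contMDiffAt
    ((ε.isOpen_dom.inter s.isOpen_dom).mem_nhds hx)).mdifferentiableAt (by simp)

theorem covDeriv_add [IsManifold (𝓡 d) ∞ P] (S : SpinStructure g e Q)
    {B : PrincipalBundle G M d P} (θ : Connection B) (Ψ Φ : TwistedSpinor S B)
    (ε : LocalGauge S.toPrincipalBundle) (s : LocalGauge B) (k : Fin 3) {x : M}
    (hx : x ∈ ε.dom ∩ s.dom) :
    covDeriv S θ (Ψ + Φ) ε s k x = covDeriv S θ Ψ ε s k x + covDeriv S θ Φ ε s k x := by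
  have h : dLocalRep (Ψ + Φ) ε s x = dLocalRep Ψ ε s x + dLocalRep Φ ε s x :=
    ((mdifferentiableAt_localRep Ψ ε s hx).hasMFDerivAt.add
      (mdifferentiableAt_localRep Φ ε s hx).hasMFDerivAt).mfderiv
  have h' : localRep (Ψ + Φ) ε s x = localRep Ψ ε s x + localRep Φ ε s x := rfl
  simp only [covDeriv, h, h', Matrix.mulVec_add, add_apply]
  abel

theorem covDeriv_smul [IsManifold (𝓡 d) ∞ P] (S : SpinStructure g e Q)
    {B : PrincipalBundle G M d P} (θ : Connection B) (c : ℂ) (Ψ : TwistedSpinor S B)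
    (ε : LocalGauge S.toPrincipalBundle) (s : LocalGauge B) (k : Fin 3) {x : M}
    (hx : x ∈ ε.dom ∩ s.dom) :
    covDeriv S θ (c • Ψ) ε s k x = c • covDeriv S θ Ψ ε s k x := by
  let L : Fibre N →L[ℝ] Fibre N := (c • ContinuousLinearMap.id ℂ (Fibre N)).restrictScalars ℝ
  have h : dLocalRep (c • Ψ) ε s x = L.comp (dLocalRep Ψ ε s x) :=
    (L.hasMFDerivAt.comp x (mdifferentiableAt_localRep Ψ ε s hx).hasMFDerivAt).mfderiv
  have h' : localRep (c • Ψ) ε s x = c • localRep Ψ ε s x := rfl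
  simp only [covDeriv, h, h', Matrix.mulVec_smul, smul_add]
  rfl

/-- The twisted Dirac operator `D_ω : Γ(ΣM ⊗ E) → Γ(ΣM ⊗ E)`, `D_ω Ψ = ∑ k, e_k · ∇̃_{e_k} Ψ`.
The section `D_ω Ψ` is given through its local representatives in all pairs of a local section `ε`
of the spin bundle and a local gauge `s`, on the common domain of the two. -/
def dirac [IsManifold (𝓡 d) ∞ P] (S : SpinStructure g e Q) {B : PrincipalBundle G M d P}
    (θ : Connection B) :
    TwistedSpinor S B →ₗ[ℂ]
      (∀ (ε : LocalGauge S.toPrincipalBundle) (s : LocalGauge B), ↥(ε.dom ∩ s.dom) → Fibre N) where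
  toFun Ψ ε s x := ∑ k, (gamma k ⊗ₖ (1 : Mat N)) *ᵥ covDeriv S θ Ψ ε s k x
  map_add' Ψ Φ := by
    funext ε s x
    simp only [covDeriv_add S θ Ψ Φ ε s _ x.2, Matrix.mulVec_add, Finset.sum_add_distrib,
      Pi.add_apply]
  map_smul' c Ψ := by
    funext ε s x
    simp only [covDeriv_smul S θ c Ψ ε s _ x.2, Matrix.mulVec_smul, Finset.smul_sum,
      Pi.smul_apply, RingHom.id_apply]

/-- The Dirac current `J(Ψ) ∈ Ω¹(M; ad P)`, where `ad P = P ×_G 𝔤` carries the inner product `κ`.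
For `q ∈ Q` and `p ∈ P` over `x`, `diracCurrent κ Ψ q p k ∈ 𝔤` represents the value `J(Ψ)(e_k)` in
the gauge `p`, where `e_1, e_2, e_3` is the orthonormal frame of `T_x M` given by `q`. It is the
element of `𝔤` determined by `κ(J(Ψ)(e_k), A) = - ½ ⟨Ψ, e_k · A Ψ⟩` for all `A ∈ 𝔤`
(the right-hand side is real); that is, `⟨J(Ψ), η⟩ = - ½ ⟨Ψ, ∑ k, e_k · η(e_k) Ψ⟩` for all
`η ∈ Ω¹(M; ad P)`. -/
def diracCurrent {S : SpinStructure g e Q} {B : PrincipalBundle G M d P}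
    (κ : AdInvariantInnerProduct G) (Ψ : TwistedSpinor S B) : Q → P → Fin 3 → lieAlg G :=
  fun q p k => (κ.form.toDual κ.nondegenerate).symm
    { toFun := fun A => -(1 / 2 : ℝ) *
        (star ((Ψ : Q → P → Fibre N) q p) ⬝ᵥ
          ((gamma k ⊗ₖ (A : Mat N)) *ᵥ (Ψ : Q → P → Fibre N) q p)).re
      map_add' := fun A A' => by
        simp only [Submodule.coe_add, Matrix.kronecker_add, Matrix.add_mulVec, dotProduct_add,
          Complex.add_re, mul_add]
      map_smul' := fun c A => by
        simp only [Submodule.coe_smul, Matrix.kronecker_smul, Matrix.smul_mulVec, dotProduct_smul,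
          Complex.smul_re, RingHom.id_apply, smul_eq_mul]
        ring }

/-- `ω` is decoupling: the current of each `Ψ ∈ ker D_ω` vanishes. -/
def IsDecoupling [IsManifold (𝓡 d) ∞ P] (S : SpinStructure g e Q) {B : PrincipalBundle G M d P}
    (κ : AdInvariantInnerProduct G) (θ : Connection B) : Prop :=
  ∀ Ψ ∈ LinearMap.ker (dirac S θ), diracCurrent κ Ψ = 0

/-- `ω` is perturbation minimal: it is a local minimum of `ω ↦ dim ker D_ω` in the `C^∞` topology
(the dimension is taken as a cardinal, so that no convention for infinite dimension enters). -/
def IsPerturbationMinimal [IsManifold (𝓡 d) ∞ P] (S : SpinStructure g e Q)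
    {B : PrincipalBundle G M d P} (θ : Connection B) : Prop :=
  ∃ U ∈ 𝓝 θ, ∀ θ' ∈ U,
    Module.rank ℂ (LinearMap.ker (dirac S θ)) ≤ Module.rank ℂ (LinearMap.ker (dirac S θ'))

end Spin

end DiracYangMills

end

namespace DiracYangMills

/-! ### Elements of the Lie algebras of `U(N)` and `SU(N)` -/

/-! The vanishing of the current is a pointwise algebraic condition. Since the inner product on `𝔤`
is nondegenerate, it says that `⟨ψ, (γ_k ⊗ A) ψ⟩` has zero real part for every `k`, every `A ∈ 𝔤`
and every value `ψ` of `Ψ`. Write `ψ = (ψ_a)` with `ψ_a ∈ ℂ²`, one for each coordinate of `ℂ^N`.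

For `U(N)`, the matrix `i E_aa` kills the Bloch vector `⟨ψ_a, σ_k ψ_a⟩`, whose length is `|ψ_a|²`
(`eq_zero_of_forall_re_single`).

For `SU(N)`, choose `b ≠ a`. Off-diagonal matrices give `⟨ψ_a, σ_k ψ_b⟩ = 0` for all `k`, so the
matrix `ψ_b ψ_a*` is scalar; having rank at most one in dimension two, it is zero, and one of `ψ_a`,
`ψ_b` vanishes. The matrix `i (E_aa - E_bb)` makes their Bloch vectors equal, so the other vanishes
too (`eq_zero_of_forall_re_pair`).

A decoupling connection therefore has trivial Dirac kernel, and dimension zero is a minimum over all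
connections. No analysis of the Dirac operator enters. -/

theorem exp_smul_mem_unitaryGroup {N : ℕ} {A : Mat N} (hA : Aᴴ = -A) (t : ℝ) :
    NormedSpace.exp (t • A) ∈ Matrix.unitaryGroup (Fin N) ℂ := by
  rw [Matrix.mem_unitaryGroup_iff, Matrix.star_eq_conjTranspose, ← Matrix.exp_conjTranspose,
    Matrix.conjTranspose_smul, hA, star_trivial, smul_neg, Matrix.exp_neg]
  exact Matrix.mul_nonsing_inv _ ((Matrix.isUnit_iff_isUnit_det _).1 (Matrix.isUnit_exp _))

theorem mem_lieAlg_unitaryGroup {N : ℕ} {A : Mat N} (hA : Aᴴ = -A) :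
    A ∈ lieAlg (Matrix.unitaryGroup (Fin N) ℂ) :=
  Submodule.subset_span (exp_smul_mem_unitaryGroup hA)

/-- Unitary diagonalisation reduces the determinant to a product of exponentials of eigenvalues.
With `H = -i t A` this shows that a traceless skew-Hermitian `A` exponentiates into `SU(N)`. -/
theorem det_exp_I_smul_of_isHermitian {N : ℕ} {H : Mat N} (hH : H.IsHermitian) :
    (NormedSpace.exp (Complex.I • H)).det = Complex.exp (Complex.I * H.trace) := by
  have hU : IsUnit (hH.eigenvectorUnitary : Mat N) := (Unitary.toUnits hH.eigenvectorUnitary).isUnit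
  have hinv : star (hH.eigenvectorUnitary : Mat N) = (hH.eigenvectorUnitary : Mat N)⁻¹ :=
    (Matrix.inv_eq_left_inv (Unitary.coe_star_mul_self hH.eigenvectorUnitary)).symm
  have hspec : Complex.I • H = (hH.eigenvectorUnitary : Mat N)
      * Matrix.diagonal (fun i => Complex.I * (hH.eigenvalues i : ℂ))
      * (hH.eigenvectorUnitary : Mat N)⁻¹ := by
    conv_lhs => rw [hH.spectral_theorem, Unitary.conjStarAlgAut_apply, hinv]
    rw [← smul_mul_assoc, ← mul_smul_comm, ← Matrix.diagonal_smul]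
    rfl
  rw [hspec, Matrix.exp_conj _ _ hU, Matrix.det_conj hU, Matrix.exp_diagonal,
    Matrix.det_diagonal, hH.trace_eq_sum_eigenvalues, Finset.mul_sum, Complex.exp_sum]
  refine Finset.prod_congr rfl fun i _ => ?_
  rw [Complex.exp_eq_exp_ℂ, Pi.coe_exp]
  rfl

theorem mem_lieAlg_specialUnitaryGroup {N : ℕ} {A : Mat N} (hA : Aᴴ = -A) (htr : A.trace = 0) :
    A ∈ lieAlg (Matrix.specialUnitaryGroup (Fin N) ℂ) := by
  refine Submodule.subset_span fun t => Matrix.mem_specialUnitaryGroup_iff.2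
    ⟨exp_smul_mem_unitaryGroup hA t, ?_⟩
  have hH : (-(Complex.I • (t • A))).IsHermitian := by
    simp [Matrix.IsHermitian, Matrix.conjTranspose_smul, hA]
  have h := det_exp_I_smul_of_isHermitian hH
  rwa [smul_neg, smul_smul, Complex.I_mul_I, neg_smul, one_smul, neg_neg, Matrix.trace_neg,
    Matrix.trace_smul, Matrix.trace_smul, htr, smul_zero, smul_zero, neg_zero, mul_zero,
    Complex.exp_zero] at h

/-! ### The quadratic form of the Dirac current -/

theorem dotProduct_kronecker_single_mulVec {N : ℕ} (ψ : Fibre N) (m : Mat 2) (a b : Fin N)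
    (c : ℂ) :
    star ψ ⬝ᵥ ((m ⊗ₖ Matrix.single a b c) *ᵥ ψ)
      = c * ∑ i, ∑ j, star (ψ (i, a)) * m i j * ψ (j, b) := by
  simp only [dotProduct, Matrix.mulVec, Fintype.sum_prod_type, Matrix.kronecker_apply,
    Matrix.single_apply, Pi.star_apply, Finset.mul_sum, mul_ite, ite_mul, mul_zero, zero_mul,
    ite_and, Finset.sum_ite_eq, Finset.mem_univ, if_true, Finset.sum_ite_irrel,
    Finset.sum_const_zero]
  refine Finset.sum_congr rfl fun i _ => Finset.sum_congr rfl fun j _ => ?_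
  ring

/-- Taking `c = 1` compares the real parts and `c = i` the imaginary parts. -/
theorem eq_zero_of_forall_re_mul_sub {u v : ℂ}
    (h : ∀ c : ℂ, (c * u - star c * v).re = 0) : u = star v := by
  have h1 := h 1
  have hI := h Complex.I
  simp at h1 hI
  apply Complex.ext <;> simp <;> linarith

/-- The coordinate form of the `SU(N)` argument, with `ψ_a = (x, y)` and `ψ_b = (z, w)`. The first
three hypotheses express `⟨ψ_a, σ_k ψ_b⟩ = 0`, the last two the equality of the Bloch vectors. -/
theorem pair_eq_zero {x y z w : ℂ} (hxw : star x * w = 0) (hyz : star y * z = 0)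
    (hxz : star x * z = star y * w) (hxy : star x * y = star z * w)
    (hn : Complex.normSq x + Complex.normSq w = Complex.normSq y + Complex.normSq z) :
    x = 0 ∧ y = 0 := by
  by_cases hx : x = 0
  · subst hx
    refine ⟨rfl, by_contra fun hy => hy ?_⟩
    have hz : z = 0 := by simpa [hy] using hyz
    have hw : w = 0 := by simpa [hy] using hxz.symm
    simpa [hz, hw] using hn.symm
  · have hw : w = 0 := by simpa [hx] using hxw
    have hz : z = 0 := by simpa [hx, hw] using hxz
    have hy : y = 0 := by simpa [hx, hw] using hxy
    simp [hw, hz, hy, hx] at hn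

/-- If `⟨ψ, γ_k ⊗ A ψ⟩` vanishes for the elements `A` of a copy of `𝔰𝔲(2)` acting on two
coordinates `a ≠ b`, then the components of `ψ` at `a` (and, by symmetry, at `b`) vanish. -/
theorem eq_zero_of_forall_re_pair {N : ℕ} {ψ : Fibre N} {a b : Fin N} (hab : a ≠ b)
    (h : ∀ k (A : Mat N), Aᴴ = -A → A.trace = 0 →
      (star ψ ⬝ᵥ ((gamma k ⊗ₖ A) *ᵥ ψ)).re = 0) (i : Fin 2) : ψ (i, a) = 0 := by
  -- As `γ_k` is skew-Hermitian, the right-hand side is the negative of the left, so this amounts to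
  -- `⟨ψ_a, γ_k ψ_b⟩ = 0`.
  have hoff : ∀ k, ∑ i, ∑ j, star (ψ (i, a)) * gamma k i j * ψ (j, b)
      = star (∑ i, ∑ j, star (ψ (i, b)) * gamma k i j * ψ (j, a)) := fun k => by
    refine eq_zero_of_forall_re_mul_sub fun c => ?_
    have h' := h k (Matrix.single a b c - Matrix.single b a (star c))
      (by simp [Matrix.conjTranspose_single])
      (by simp [Matrix.trace_single_eq_of_ne, hab, hab.symm])
    rwa [sub_eq_add_neg, Matrix.single_neg, Matrix.kronecker_add, Matrix.add_mulVec,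
      dotProduct_add, dotProduct_kronecker_single_mulVec, dotProduct_kronecker_single_mulVec,
      neg_mul, ← sub_eq_add_neg] at h'
  have hdiag : ∀ k, (Complex.I * ∑ i, ∑ j, star (ψ (i, a)) * gamma k i j * ψ (j, a)
      + -Complex.I * ∑ i, ∑ j, star (ψ (i, b)) * gamma k i j * ψ (j, b)).re = 0 := fun k => by
    have h' := h k (Matrix.single a a Complex.I + Matrix.single b b (-Complex.I))
      (by simp [Matrix.conjTranspose_single, Matrix.single_neg, add_comm]) (by simp)
    rwa [Matrix.kronecker_add, Matrix.add_mulVec, dotProduct_add,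
      dotProduct_kronecker_single_mulVec, dotProduct_kronecker_single_mulVec] at h'
  have o0 := hoff 0
  have o1 := hoff 1
  have o2 := hoff 2
  have d0 := hdiag 0
  have d1 := hdiag 1
  have d2 := hdiag 2
  simp [gamma, pauli, Fin.sum_univ_two] at o0 o1 o2 d0 d1 d2
  -- The combinations `σ₁ ± i σ₂` isolate the two mixed products. The factors `i` undo `γ_k = -i
  -- σ_k`, and the multiples of `Complex.I_sq` clear the resulting `i²`.
  have h0 := pair_eq_zero (x := ψ (0, a)) (y := ψ (1, a)) (z := ψ (0, b)) (w := ψ (1, b))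
    (by
      simp only [Complex.star_def]
      linear_combination (Complex.I / 4) * o0 - o1 / 4
        + ((starRingEnd ℂ) (ψ (0, a)) * ψ (1, b) + (starRingEnd ℂ) (ψ (1, a)) * ψ (0, b)) / 2
          * Complex.I_sq)
    (by
      simp only [Complex.star_def]
      linear_combination (Complex.I / 4) * o0 + o1 / 4
        + ((starRingEnd ℂ) (ψ (0, a)) * ψ (1, b) + (starRingEnd ℂ) (ψ (1, a)) * ψ (0, b)) / 2
          * Complex.I_sq)
    (by
      simp only [Complex.star_def]
      linear_combination (Complex.I / 2) * o2
        + ((starRingEnd ℂ) (ψ (0, a)) * ψ (0, b) - (starRingEnd ℂ) (ψ (1, a)) * ψ (1, b))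
          * Complex.I_sq)
    (by apply Complex.ext <;> simp <;> linarith)
    (by simp only [Complex.normSq_apply]; linarith)
  fin_cases i
  exacts [h0.1, h0.2]

theorem eq_zero_of_forall_re_single {N : ℕ} {ψ : Fibre N}
    (h : ∀ k (A : Mat N), Aᴴ = -A → (star ψ ⬝ᵥ ((gamma k ⊗ₖ A) *ᵥ ψ)).re = 0) (i : Fin 2)
    (a : Fin N) : ψ (i, a) = 0 := by
  have hdiag : ∀ k, (Complex.I * ∑ i, ∑ j, star (ψ (i, a)) * gamma k i j * ψ (j, a)).re = 0 :=
    fun k => by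
      have h' := h k (Matrix.single a a Complex.I)
        (by simp [Matrix.conjTranspose_single, Matrix.single_neg])
      rwa [dotProduct_kronecker_single_mulVec] at h'
  have d0 := hdiag 0
  have d1 := hdiag 1
  have d2 := hdiag 2
  simp [gamma, pauli, Fin.sum_univ_two] at d0 d1 d2
  -- The identity `∑ k, ⟨φ, σ_k φ⟩² = |φ|⁴` on `ℂ²`: each vanishing Bloch component is multiplied by
  -- itself and the products are added.
  have h2 : (Complex.normSq (ψ (0, a)) + Complex.normSq (ψ (1, a))) ^ 2 = 0 := by
    simp only [Complex.normSq_apply]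
    generalize (ψ (0, a)).re = x at *
    generalize (ψ (0, a)).im = x' at *
    generalize (ψ (1, a)).re = y at *
    generalize (ψ (1, a)).im = y' at *
    linear_combination 2 * (x * y + x' * y') * d0 + 2 * (x * y' - x' * y) * d1
      + (x * x + x' * x' - y * y - y' * y') * d2
  obtain ⟨hx, hy⟩ := (add_eq_zero_iff_of_nonneg (Complex.normSq_nonneg _)
    (Complex.normSq_nonneg _)).1 (pow_eq_zero_iff two_ne_zero |>.1 h2)
  fin_cases i
  exacts [Complex.normSq_eq_zero.1 hx, Complex.normSq_eq_zero.1 hy]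

/-! ### From pointwise algebra to the kernel of the current -/

section Current

variable {M : Type*} [TopologicalSpace M] [ChartedSpace E3 M] [IsManifold (𝓡 3) ∞ M]
  {g : Bundle.ContMDiffRiemannianMetric (𝓡 3) ∞ E3 (fun x : M => TangentSpace (𝓡 3) x)}
  {e : ℕ} {Q : Type*} [TopologicalSpace Q] [ChartedSpace (EuclideanSpace ℝ (Fin e)) Q]
  {S : SpinStructure g e Q} {N : ℕ} {G : Submonoid (Mat N)}
  {d : ℕ} {P : Type*} [TopologicalSpace P] [ChartedSpace (EuclideanSpace ℝ (Fin d)) P]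
  {B : PrincipalBundle G M d P}

/-- Duality with respect to `κ` is an isomorphism, so the current vanishes exactly when the
functional representing it does; `κ` then drops out. -/
theorem diracCurrent_eq_zero_iff (κ : AdInvariantInnerProduct G) (Ψ : TwistedSpinor S B) :
    diracCurrent κ Ψ = 0 ↔ ∀ q p k, ∀ A ∈ lieAlg G,
      (star ((Ψ : Q → P → Fibre N) q p) ⬝ᵥ
        ((gamma k ⊗ₖ A) *ᵥ (Ψ : Q → P → Fibre N) q p)).re = 0 := by
  simp only [funext_iff, diracCurrent, Pi.zero_apply, LinearEquiv.map_eq_zero_iff,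
    LinearMap.ext_iff, LinearMap.coe_mk, AddHom.coe_mk, LinearMap.zero_apply, Subtype.forall]
  simp

theorem diracCurrent_eq_zero_iff_eq_zero
    (hG : (G = Matrix.specialUnitaryGroup (Fin N) ℂ ∧ N ≠ 1) ∨ G = Matrix.unitaryGroup (Fin N) ℂ)
    (κ : AdInvariantInnerProduct G) (Ψ : TwistedSpinor S B) :
    diracCurrent κ Ψ = 0 ↔ Ψ = 0 := by
  rw [diracCurrent_eq_zero_iff]
  refine ⟨fun h => Subtype.ext (funext fun q => funext fun p => funext fun ⟨i, a⟩ => ?_), ?_⟩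
  · rcases hG with ⟨rfl, hN⟩ | rfl
    -- The index `a` forces `N ≥ 1`, so `N ≠ 1` leaves `N ≥ 2` and a second index `b` exists; for `N
    -- = 0` there is nothing to prove.
    · have : Nontrivial (Fin N) := Fin.nontrivial_iff_two_le.2 (by have := a.pos; omega)
      obtain ⟨b, hb⟩ := exists_ne a
      exact eq_zero_of_forall_re_pair hb.symm
        (fun k A hA htr => h q p k A (mem_lieAlg_specialUnitaryGroup hA htr)) i
    · exact eq_zero_of_forall_re_single
        (fun k A hA => h q p k A (mem_lieAlg_unitaryGroup hA)) i a
  · rintro rfl q p k A -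
    simp

end Current

end DiracYangMills

open DiracYangMills in
theorem theorem1p5
    {M : Type*} [TopologicalSpace M] [ChartedSpace E3 M] [IsManifold (𝓡 3) ∞ M]
    [CompactSpace M] [T2Space M]
    (g : Bundle.ContMDiffRiemannianMetric (𝓡 3) ∞ E3 (fun x : M => TangentSpace (𝓡 3) x))
    {e : ℕ} {Q : Type*} [TopologicalSpace Q] [ChartedSpace (EuclideanSpace ℝ (Fin e)) Q]
    [IsManifold (𝓡 e) ∞ Q] (S : SpinStructure g e Q)
    {N : ℕ} (G : Submonoid (Mat N))
    (hG : (G = Matrix.specialUnitaryGroup (Fin N) ℂ ∧ N ≠ 1) ∨ G = Matrix.unitaryGroup (Fin N) ℂ)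
    {d : ℕ} {P : Type*} [TopologicalSpace P] [ChartedSpace (EuclideanSpace ℝ (Fin d)) P]
    [IsManifold (𝓡 d) ∞ P] (B : PrincipalBundle G M d P)
    (κ : AdInvariantInnerProduct G) :
    (∀ Ψ : TwistedSpinor S B, diracCurrent κ Ψ = 0 ↔ Ψ = 0) ∧
    ∀ θ : Connection B, IsDecoupling S κ θ →
      IsPerturbationMinimal S θ ∧ Module.rank ℂ (LinearMap.ker (dirac S θ)) = 0 := by
  have hJ := fun Ψ : TwistedSpinor S B => diracCurrent_eq_zero_iff_eq_zero hG κ Ψ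
  refine ⟨hJ, fun θ hθ => ?_⟩
  have hrank : Module.rank ℂ (LinearMap.ker (dirac S θ)) = 0 := by
    rw [(LinearMap.ker (dirac S θ)).eq_bot_iff.2 fun Ψ hΨ => (hJ Ψ).1 (hθ Ψ hΨ), rank_bot]
  -- Rank zero is a global minimum, so the whole space of connections serves as the neighbourhood.
  exact ⟨⟨Set.univ, Filter.univ_mem, fun θ' _ => hrank ▸ zero_le⟩, hrank⟩
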